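/- For $k\in\{1,2,\dots\}$ let $f_k:[\frac1{k+1},\frac1k]\to[0,1]$ be the decreasing affine bijection with $f_k(\frac1{k+1})=1$ and $f_k(\frac1k)=0$, and let $g_k=f_k^{-1}:[0,1]\to[\frac1{k+1},\frac1k]$. For $n\ge 1$ let $$J_n=\bigcap_{l=1}^{\infty}\ \bigcup_{q_1,\dots,q_l\in\{1,\dots,n\}} g_{q_1}\circ\cdots\circ g_{q_l}([0,1])$$ be the limit set of the iterated function system $\{g_1,\dots,g_n\}$. For $E\subset\mathbb R$ and $\delta>0$, a $\delta$-packing of $E$ is a countable family of pairwise disjoint closed balls with centers in $E$ and positive radii at most $\delta$. For $s\ge 0$ put $$P_s(E)=\inf_{\delta>0}\ \sup\Big\{\sum_{B\in\mathcal R}|B|^s:\ \mathcal R\text{ is a }\delta\text{-packing of }E\Big\},$$ where $|B|$ is the diameter of $B$, and let $$\mathcal P_s(E)=\inf\Big\{\sum_{i=1}^{\infty}P_s(E_i):\ E\subset\bigcup_{i=1}^{\infty}E_i\Big\}$$ be the $s$-dimensional packing measure of $E$. Let $h_n=\inf\{s\ge0:\mathcal P_s(J_n)=0\}$ be the packing dimension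 of $J_n$. Then $$\lim_{n\to\infty}\mathcal P_{h_n}(J_n)=2.$$ -/

import Mathlib

open Set Filter Topology
open scoped ENNReal

namespace LinearGauss

noncomputable section

/-! ## Packing measure and packing dimension on the real line -/

/-- `R` is a `δ`-packing of `E ⊆ ℝ`: a countable family of pairwise disjoint closed balls
with centers in `E` and (positive) radii at most `δ`. -/
structure IsPacking (δ : ℝ) (E : Set ℝ) (R : Set (Set ℝ)) : Prop where
  countable : R.Countable
  pairwiseDisjoint : R.PairwiseDisjoint id
  isBall : ∀ B ∈ R, ∃ x ∈ E, ∃ r : ℝ, 0 < r ∧ r ≤ δ ∧ B = Metric.closedBall x r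

/-- The supremum of `∑ |B| ^ s` over all `δ`-packings of `E`, where `|B|` is the diameter. -/
def packingDelta (s δ : ℝ) (E : Set ℝ) : ℝ≥0∞ :=
  ⨆ (R : Set (Set ℝ)) (_ : IsPacking δ E R), ∑' B : R, Metric.ediam (B : Set ℝ) ^ s

/-- The `s`-dimensional packing premeasure. -/
def packingPremeasure (s : ℝ) (E : Set ℝ) : ℝ≥0∞ :=
  ⨅ (δ : ℝ) (_ : 0 < δ), packingDelta s δ E

/-- The `s`-dimensional packing measure. -/
def packingMeasure (s : ℝ) (E : Set ℝ) : ℝ≥0∞ :=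
  ⨅ (F : ℕ → Set ℝ) (_ : E ⊆ ⋃ i, F i), ∑' i, packingPremeasure s (F i)

/-- The packing dimension of a subset of the line. The set of exponents is bounded below by `0`
and contains every `s > 1`, so the real infimum is a genuine one. -/
def packingDim (E : Set ℝ) : ℝ :=
  sInf {s : ℝ | 0 ≤ s ∧ packingMeasure s E = 0}

/-! ## The linear analogue of the Gauss map and its limit sets -/

/-- The decreasing affine function with `f k (1 / (k + 1)) = 1` and `f k (1 / k) = 0`
(used for `k ≥ 1`, on the interval `[1 / (k + 1), 1 / k]`). -/
def f (k : ℕ) (x : ℝ) : ℝ := (1 / (k : ℝ) - x) / (1 / (k : ℝ) - 1 / ((k : ℝ) + 1))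

/-- The inverse branch of `f k`, mapping `[0, 1]` onto `[1 / (k + 1), 1 / k]`. -/
def g (k : ℕ) (y : ℝ) : ℝ := 1 / (k : ℝ) - (1 / (k : ℝ) - 1 / ((k : ℝ) + 1)) * y

theorem gap_pos {k : ℕ} (hk : 1 ≤ k) : 0 < 1 / (k : ℝ) - 1 / ((k : ℝ) + 1) := by
  have h : (0 : ℝ) < k := by exact_mod_cast hk
  have h2 : 1 / ((k : ℝ) + 1) < 1 / (k : ℝ) := one_div_lt_one_div_of_lt h (by linarith)
  linarith

theorem f_left {k : ℕ} (hk : 1 ≤ k) : f k (1 / ((k : ℝ) + 1)) = 1 :=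
  div_self (gap_pos hk).ne'

theorem f_right (k : ℕ) : f k (1 / (k : ℝ)) = 0 := by simp [f]

theorem f_g {k : ℕ} (hk : 1 ≤ k) (y : ℝ) : f k (g k y) = y := by
  have h := (gap_pos hk).ne'
  unfold f g
  rw [sub_sub_cancel, mul_div_cancel_left₀ _ h]

theorem g_f {k : ℕ} (hk : 1 ≤ k) (x : ℝ) : g k (f k x) = x := by
  have h := (gap_pos hk).ne'
  unfold f g
  rw [mul_div_cancel₀ _ h, sub_sub_cancel]

/-- The composition `g q₁ ∘ g q₂ ∘ ⋯ ∘ g q_l` along the word `q = [q₁, …, q_l]`. -/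
def gWord (q : List ℕ) : ℝ → ℝ := (q.map g).foldr (fun u v => u ∘ v) id

/-- The limit set of the system `g 1, …, g n`: the intersection over `l ≥ 1` of the unions
of the images of `[0, 1]` under all words of length `l` in the letters `1, …, n`. -/
def J (n : ℕ) : Set ℝ :=
  ⋂ (l : ℕ) (_ : 1 ≤ l), ⋃ (q : List ℕ) (_ : q.length = l ∧ ∀ k ∈ q, 1 ≤ k ∧ k ≤ n),
    gWord q '' Icc 0 1

/-- The packing dimension `h_n` of the limit set `J_n`. -/
def h (n : ℕ) : ℝ := packingDim (J n)

end

end LinearGauss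

/-! The contraction ratios are `ratio k` = 1/(k(k+1)). Let s in [0,1] solve ∑ `ratio k` ^ s = 1 over
k ≤ n, and let m be the self-similar probability measure with weights `ratio k` ^ s, which is
carried by `J n`. The packing measure is governed by the smallest value of m(B(x,r)) / (2r)^s at
small scales, and this value tends to 1/2.

Upper bound (`le_measure_closedBall`): every ball centered in `J n` with r ≤ 1 has mass at least
`ballConst n s` * (2r)^s. Rescaling by inverse branches reduces to a ball whose radius exceeds the
length of the cylinder of its center. There m is nearly at least Lebesgue measure (`le_real_Icc`),
and a one-sided half of the ball already gives almost r, or else the ball covers [0,1]. Summing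
masses over a packing bounds the packing measure by 1 / `ballConst`.

Lower bound (`ae_exists_closedBall_le`): no mass lies in (0, 1/(n+1)), so a ball of radius 1/(n+1)
about a point of the leftmost cylinder has mass only about half its diameter. Since m-almost every
orbit meets the letter n after any number of steps, scaled copies of such balls occur at arbitrarily
small scales around almost every point. Besicovitch's covering theorem turns them into packings and
gives the lower bound 1 / `lightConst`.

Together the bounds identify s with `h n`. Finally 1 - s ≤ 2/n while `ratio n` decays polynomially,
so `ratio n` ^ (s - 1) → 1 and both bounds tend to 2. -/

namespace LinearGauss

open MeasureTheory Metric

/-! ## The inverse branches -/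

/-- The contraction ratio `1 / (k (k + 1))` of the branch `g k`. -/
noncomputable def ratio (k : ℕ) : ℝ := 1 / (k : ℝ) - 1 / ((k : ℝ) + 1)

theorem g_eq (k : ℕ) (y : ℝ) : g k y = 1 / (k : ℝ) - ratio k * y := rfl

theorem ratio_pos {k : ℕ} (hk : 1 ≤ k) : 0 < ratio k := gap_pos hk

theorem ratio_eq {k : ℕ} (hk : 1 ≤ k) : ratio k = 1 / ((k : ℝ) * (k + 1)) := by
  have h : (0 : ℝ) < k := by exact_mod_cast hk
  unfold ratio
  field_simp
  ring

theorem ratio_anti {j k : ℕ} (hj : 1 ≤ j) (hjk : j ≤ k) : ratio k ≤ ratio j := by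
  rw [ratio_eq hj, ratio_eq (hj.trans hjk)]
  have h : (0 : ℝ) < j := by exact_mod_cast hj
  have h' : (j : ℝ) ≤ k := by exact_mod_cast hjk
  gcongr

theorem ratio_one : ratio 1 = 1 / 2 := by norm_num [ratio]

theorem ratio_two : ratio 2 = 1 / 6 := by norm_num [ratio]

theorem ratio_le_half {k : ℕ} (hk : 1 ≤ k) : ratio k ≤ 1 / 2 :=
  ratio_one ▸ ratio_anti le_rfl hk

theorem ratio_le_three_mul {j : ℕ} (hj : 1 ≤ j) : ratio j ≤ 3 * ratio (j + 1) := by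
  rw [ratio_eq hj, ratio_eq (by omega)]
  have h : (1 : ℝ) ≤ j := by exact_mod_cast hj
  push_cast
  rw [mul_one_div, div_le_div_iff₀ (by positivity) (by positivity)]
  nlinarith

theorem one_div_succ_add_ratio (k : ℕ) : 1 / ((k : ℝ) + 1) + ratio k = 1 / (k : ℝ) := by
  unfold ratio; ring

theorem g_mem_Icc {k : ℕ} (hk : 1 ≤ k) {y : ℝ} (hy : y ∈ Icc (0 : ℝ) 1) :
    g k y ∈ Icc (1 / ((k : ℝ) + 1)) (1 / (k : ℝ)) := by
  have h := ratio_pos hk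
  have h2 := one_div_succ_add_ratio k
  rw [g_eq]
  constructor <;> nlinarith [hy.1, hy.2]

theorem Icc_cylinder_subset {k : ℕ} (hk : 1 ≤ k) :
    Icc (1 / ((k : ℝ) + 1)) (1 / (k : ℝ)) ⊆ Icc 0 1 := by
  have h : (1 : ℝ) ≤ k := by exact_mod_cast hk
  apply Icc_subset_Icc (by positivity)
  rw [div_le_one (by linarith)]
  exact h

theorem mapsTo_g {k : ℕ} (hk : 1 ≤ k) : MapsTo (g k) (Icc 0 1) (Icc 0 1) :=
  fun _ hy => Icc_cylinder_subset hk (g_mem_Icc hk hy)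

theorem f_mem_Icc {k : ℕ} (hk : 1 ≤ k) {x : ℝ}
    (hx : x ∈ Icc (1 / ((k : ℝ) + 1)) (1 / (k : ℝ))) : f k x ∈ Icc (0 : ℝ) 1 := by
  have h := ratio_pos hk
  have h2 := one_div_succ_add_ratio k
  have h3 : f k x = (1 / (k : ℝ) - x) / ratio k := rfl
  rw [h3]
  refine ⟨div_nonneg (by linarith [hx.2]) h.le, ?_⟩
  rw [div_le_one h]
  linarith [hx.1]

theorem ratio_mul_f {k : ℕ} (hk : 1 ≤ k) (x : ℝ) : ratio k * f k x = 1 / (k : ℝ) - x := by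
  have := g_f hk x
  rw [g_eq] at this
  linarith

theorem g_sub (k : ℕ) (x y : ℝ) : g k x - g k y = ratio k * (y - x) := by
  simp only [g_eq]; ring

theorem abs_g_sub {k : ℕ} (hk : 1 ≤ k) (x y : ℝ) : |g k x - g k y| = ratio k * |x - y| := by
  rw [g_sub, abs_mul, abs_of_pos (ratio_pos hk), abs_sub_comm]

theorem continuous_g (k : ℕ) : Continuous (g k) := by
  unfold g; fun_prop

theorem injective_g {k : ℕ} (hk : 1 ≤ k) : Function.Injective (g k) :=
  Function.LeftInverse.injective (f_g hk)

theorem measurableEmbedding_g {k : ℕ} (hk : 1 ≤ k) : MeasurableEmbedding (g k) :=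
  (continuous_g k).measurableEmbedding (injective_g hk)

theorem preimage_g_closedBall {k : ℕ} (hk : 1 ≤ k) (y r : ℝ) :
    g k ⁻¹' closedBall (g k y) r = closedBall y (r / ratio k) := by
  ext z
  rw [mem_preimage, mem_closedBall, mem_closedBall, Real.dist_eq, Real.dist_eq, abs_g_sub hk,
    le_div_iff₀ (ratio_pos hk), mul_comm]

theorem exists_mem_cylinder {n : ℕ} {x : ℝ} (hn : 1 ≤ n) (h0 : 1 / ((n : ℝ) + 1) ≤ x)
    (h1 : x ≤ 1) : ∃ k ∈ Finset.Icc 1 n, x ∈ Icc (1 / ((k : ℝ) + 1)) (1 / (k : ℝ)) := by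
  induction n, hn using Nat.le_induction with
  | base => exact ⟨1, by simp, h0, by simpa using h1⟩
  | succ n hn ih =>
    rcases le_total (1 / ((n : ℝ) + 1)) x with h | h
    · obtain ⟨k, hk, hx⟩ := ih h
      refine ⟨k, ?_, hx⟩
      simp only [Finset.mem_Icc] at hk ⊢
      omega
    · exact ⟨n + 1, by simp, h0, by push_cast; exact h⟩

theorem sum_ratio_Ico {j k : ℕ} (hjk : j ≤ k) :
    ∑ i ∈ Finset.Ico j k, ratio i = 1 / (j : ℝ) - 1 / (k : ℝ) := by
  have := Finset.sum_Ico_sub (fun i : ℕ => -(1 / (i : ℝ))) hjk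
  simp only [ratio]
  push_cast at this
  rw [← neg_sub_neg, ← this]
  refine Finset.sum_congr rfl fun i _ => by ring

theorem sum_ratio_Icc (n : ℕ) : ∑ i ∈ Finset.Icc 1 n, ratio i = 1 - 1 / ((n : ℝ) + 1) := by
  have := sum_ratio_Ico (j := 1) (k := n + 1) (by omega)
  push_cast at this
  rw [div_one] at this
  exact this

/-! ## Self-similar measures -/

/-- `m` is a probability measure on `(0, 1)` which is self-similar for the branches
`g 1, …, g n` with the weights `ratio k ^ s`. -/
structure IsSelfSimilar (n : ℕ) (s : ℝ) (m : Measure ℝ) : Prop where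
  prob : IsProbabilityMeasure m
  apply_eq : ∀ E : Set ℝ,
    m E = ∑ k ∈ Finset.Icc 1 n, ENNReal.ofReal (ratio k ^ s) * m (g k ⁻¹' E)
  compl_Ioo : m (Ioo 0 1)ᶜ = 0

/-- The `l`-th approximation to the point coded by the sequence of letters `u i + 1`. -/
noncomputable def codeApprox : ℕ → (ℕ → ℕ) → ℝ
  | 0, _ => 0
  | l + 1, u => g (u 0 + 1) (codeApprox l fun i => u (i + 1))

theorem codeApprox_mem (l : ℕ) (u : ℕ → ℕ) : codeApprox l u ∈ Icc (0 : ℝ) 1 := by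
  induction l generalizing u with
  | zero => simp [codeApprox]
  | succ l ih => exact mapsTo_g (by omega) (ih _)

theorem dist_codeApprox_succ (l : ℕ) (u : ℕ → ℕ) :
    dist (codeApprox l u) (codeApprox (l + 1) u) ≤ 1 * (1 / 2) ^ l := by
  induction l generalizing u with
  | zero =>
    have := codeApprox_mem 1 u
    rw [Real.dist_eq, abs_le]
    simp only [codeApprox, pow_zero] at this ⊢
    constructor <;> linarith [this.1, this.2]
  | succ l ih =>
    have h1 := ih fun i => u (i + 1)
    rw [Real.dist_eq] at h1 ⊢
    rw [codeApprox, codeApprox, abs_g_sub (by omega)]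
    refine (mul_le_mul (ratio_le_half (by omega)) h1 (abs_nonneg _) (by norm_num)).trans_eq ?_
    ring

theorem exists_tendsto_codeApprox (u : ℕ → ℕ) :
    ∃ x, Tendsto (fun l => codeApprox l u) atTop (𝓝 x) :=
  cauchySeq_tendsto_of_complete
    (cauchySeq_of_le_geometric (1 / 2) 1 (by norm_num) fun l => dist_codeApprox_succ l u)

/-- The point coded by the sequence of letters `u i + 1`. -/
noncomputable def code (u : ℕ → ℕ) : ℝ := (exists_tendsto_codeApprox u).choose

theorem tendsto_code (u : ℕ → ℕ) : Tendsto (fun l => codeApprox l u) atTop (𝓝 (code u)) :=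
  (exists_tendsto_codeApprox u).choose_spec

theorem code_mem (u : ℕ → ℕ) : code u ∈ Icc (0 : ℝ) 1 :=
  isClosed_Icc.mem_of_tendsto (tendsto_code u) (Eventually.of_forall fun l => codeApprox_mem l u)

theorem code_eq (u : ℕ → ℕ) : code u = g (u 0 + 1) (code fun i => u (i + 1)) := by
  refine tendsto_nhds_unique ((tendsto_code u).comp (tendsto_add_atTop_nat 1)) ?_
  exact ((continuous_g _).tendsto _).comp (tendsto_code _)

theorem measurable_codeApprox (l : ℕ) : Measurable (codeApprox l) := by
  induction l with
  | zero => exact measurable_const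
  | succ l ih =>
    have h0 : Measurable fun u : ℕ → ℕ => (((u 0 + 1 : ℕ)) : ℝ) :=
      (measurable_from_top (f := fun k : ℕ => ((k + 1 : ℕ) : ℝ))).comp (measurable_pi_apply 0)
    have h1 : Measurable fun u : ℕ → ℕ => codeApprox l fun i => u (i + 1) :=
      ih.comp (measurable_pi_lambda _ fun i => measurable_pi_apply _)
    change Measurable fun u : ℕ → ℕ => g (u 0 + 1) (codeApprox l fun i => u (i + 1))
    unfold g
    fun_prop

theorem measurable_code : Measurable code :=
  measurable_of_tendsto_metrizable measurable_codeApprox (tendsto_pi_nhds.2 tendsto_code)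

/-- Prepend a letter to a sequence. -/
def consSeq (q : ℕ × (ℕ → ℕ)) : ℕ → ℕ
  | 0 => q.1
  | i + 1 => q.2 i

theorem measurable_consSeq : Measurable consSeq := by
  refine measurable_pi_lambda _ fun i => ?_
  cases i with
  | zero => exact measurable_fst
  | succ i => exact (measurable_pi_apply i).comp measurable_snd

/-- Prepending an independent letter preserves the Bernoulli measure; pushed through `code`, this
invariance becomes self-similarity. -/
theorem map_consSeq (p : Measure ℕ) [IsProbabilityMeasure p] :
    (p.prod (Measure.infinitePi fun _ : ℕ => p)).map consSeq = Measure.infinitePi fun _ => p := by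
  classical
  refine Measure.eq_infinitePi _ fun s t ht => ?_
  obtain ⟨N, hN⟩ : ∃ N, s ⊆ Finset.range (N + 1) :=
    ⟨s.sup id, fun i hi => Finset.mem_range.2 (Nat.lt_succ_of_le (Finset.le_sup (f := id) hi))⟩
  set t' : ℕ → Set ℕ := fun i => if i ∈ s then t i else univ with ht'
  have ht'm : ∀ i, MeasurableSet (t' i) := fun i => .of_discrete
  have hpre : consSeq ⁻¹' Set.pi s t =
      t' 0 ×ˢ Set.pi (Finset.range N) fun i => t' (i + 1) := by
    ext ⟨k, v⟩
    simp only [mem_preimage, Set.mem_pi, mem_prod, Finset.mem_coe, ht']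
    constructor
    · intro H
      refine ⟨?_, fun i _ => ?_⟩
      · split_ifs with h0
        · exact H 0 h0
        · trivial
      · split_ifs with h0
        · exact H (i + 1) h0
        · trivial
    · rintro ⟨H0, H⟩ i hi
      cases i with
      | zero => simpa [hi, consSeq] using H0
      | succ i =>
        have := H i (by have := Finset.mem_range.1 (hN hi); exact Finset.mem_range.2 (by omega))
        simpa [hi, consSeq] using this
  rw [Measure.map_apply measurable_consSeq (.pi s.countable_toSet fun _ _ => ht _), hpre,
    Measure.prod_prod, Measure.infinitePi_pi _ fun i _ => ht'm _]
  rw [mul_comm, ← Finset.prod_range_succ' (fun i => p (t' i)) N]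
  symm
  rw [← Finset.prod_subset hN (f := fun i => p (t' i))]
  · exact Finset.prod_congr rfl fun i hi => by simp [ht', hi]
  · intro i _ hi
    simp [ht', hi]

/-- The measure is the law of `code` for independent letters, where k has probability `ratio k` ^ s.
-/
theorem exists_isSelfSimilar {n : ℕ} {s : ℝ} (hs : ∑ k ∈ Finset.Icc 1 n, ratio k ^ s = 1) :
    ∃ m : Measure ℝ, IsSelfSimilar n s m := by
  set p : Measure ℕ :=
    ∑ k ∈ Finset.Icc 1 n, ENNReal.ofReal (ratio k ^ s) • Measure.dirac (k - 1) with hp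
  have hpos : ∀ k ∈ Finset.Icc 1 n, 0 ≤ ratio k ^ s := fun k hk =>
    Real.rpow_nonneg (ratio_pos (Finset.mem_Icc.1 hk).1).le _
  have hprob : IsProbabilityMeasure p := by
    constructor
    simp only [hp, Measure.finsetSum_apply, Measure.smul_apply, measure_univ, smul_eq_mul, mul_one]
    rw [← ENNReal.ofReal_sum_of_nonneg hpos, hs, ENNReal.ofReal_one]
  set μ : Measure (ℕ → ℕ) := Measure.infinitePi fun _ => p
  set m : Measure ℝ := μ.map code with hm
  have hmprob : IsProbabilityMeasure m := Measure.isProbabilityMeasure_map measurable_code.aemeasurable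
  have hmeas : m = ∑ k ∈ Finset.Icc 1 n, ENNReal.ofReal (ratio k ^ s) • m.map (g k) := by
    ext E hE
    have h1 : m E = ∫⁻ j, m (g (j + 1) ⁻¹' E) ∂p := by
      rw [hm, Measure.map_apply measurable_code hE]
      nth_rewrite 1 [show μ = (p.prod μ).map consSeq from (map_consSeq p).symm]
      rw [Measure.map_apply measurable_consSeq (measurable_code hE),
        Measure.prod_apply (measurable_consSeq (measurable_code hE))]
      refine lintegral_congr fun j => ?_
      rw [Measure.map_apply measurable_code ((continuous_g _).measurable hE)]
      congr 1
      ext v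
      simp only [mem_preimage]
      rw [code_eq]
      rfl
    rw [h1, hp, lintegral_finsetSum_measure]
    simp only [Measure.finsetSum_apply, Measure.smul_apply, lintegral_smul_measure, smul_eq_mul,
      lintegral_dirac]
    refine Finset.sum_congr rfl fun k hk => ?_
    rw [Measure.map_apply (continuous_g _).measurable hE,
      Nat.sub_add_cancel (Finset.mem_Icc.1 hk).1]
  -- Each branch is a measurable embedding, so the identity extends to non-measurable sets.
  have happ : ∀ E : Set ℝ,
      m E = ∑ k ∈ Finset.Icc 1 n, ENNReal.ofReal (ratio k ^ s) * m (g k ⁻¹' E) := by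
    intro E
    conv_lhs => rw [hmeas]
    simp only [Measure.finsetSum_apply, Measure.smul_apply, smul_eq_mul]
    refine Finset.sum_congr rfl fun k hk => ?_
    rw [(measurableEmbedding_g (Finset.mem_Icc.1 hk).1).map_apply]
  have hIcc : m (Icc 0 1)ᶜ = 0 := by
    rw [hm, Measure.map_apply measurable_code measurableSet_Icc.compl]
    convert measure_empty (μ := μ)
    ext u
    simpa using code_mem u
  have hnull : ∀ E : Set ℝ, (∀ k ∈ Finset.Icc 1 n, m (g k ⁻¹' E) = 0) → m E = 0 := by
    intro E hE
    rw [happ]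
    exact Finset.sum_eq_zero fun k hk => by rw [hE k hk, mul_zero]
  -- No branch takes the value 0 on [0,1], and the value 1 is taken only by `g 1` at 0. Hence both
  -- endpoints are null, and adjacent cylinders do not share mass.
  have h0 : m {0} = 0 := by
    refine hnull _ fun k hk => measure_mono_null ?_ hIcc
    intro y hy hy'
    have hk1 := (Finset.mem_Icc.1 hk).1
    have h := (g_mem_Icc hk1 hy').1
    rw [show g k y = 0 from hy] at h
    have : (0 : ℝ) < 1 / ((k : ℝ) + 1) := by positivity
    linarith
  have h1 : m {1} = 0 := by
    refine hnull _ fun k hk => measure_mono_null (t := (Icc 0 1)ᶜ ∪ {0}) ?_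
      (measure_union_null hIcc h0)
    intro y hy
    by_contra hy'
    simp only [mem_union, not_or, notMem_compl_iff, mem_singleton_iff] at hy'
    have hk1 := (Finset.mem_Icc.1 hk).1
    have hyp : 0 < y := lt_of_le_of_ne hy'.1.1 (Ne.symm hy'.2)
    have hgy : g k y = 1 := hy
    rw [g_eq] at hgy
    have := mul_pos (ratio_pos hk1) hyp
    have hk2 : 1 / (k : ℝ) ≤ 1 := by
      have : (1 : ℝ) ≤ k := by exact_mod_cast hk1
      rw [div_le_one (by linarith)]; exact this
    linarith
  refine ⟨m, hmprob, happ, measure_mono_null (t := (Icc 0 1)ᶜ ∪ {0} ∪ {1}) ?_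
    (measure_union_null (measure_union_null hIcc h0) h1)⟩
  intro y hy
  by_contra hy'
  simp only [mem_union, not_or, notMem_compl_iff, mem_singleton_iff] at hy'
  exact hy ⟨lt_of_le_of_ne hy'.1.1.1 (Ne.symm hy'.1.2), lt_of_le_of_ne hy'.1.1.2 hy'.2⟩

/-! ## Self-similar measures of intervals -/

theorem ratio_le_rpow {s : ℝ} (hs : s ≤ 1) {k : ℕ} (hk : 1 ≤ k) : ratio k ≤ ratio k ^ s := by
  have := Real.rpow_le_rpow_of_exponent_ge (ratio_pos hk)
    ((ratio_le_half hk).trans (by norm_num)) hs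
  rwa [Real.rpow_one] at this

namespace IsSelfSimilar

variable {n : ℕ} {s : ℝ} {m : Measure ℝ}

theorem real_eq (hm : IsSelfSimilar n s m) (E : Set ℝ) :
    m.real E = ∑ k ∈ Finset.Icc 1 n, ratio k ^ s * m.real (g k ⁻¹' E) := by
  have := hm.prob
  rw [measureReal_def, hm.apply_eq, ENNReal.toReal_sum fun k _ =>
    ENNReal.mul_ne_top ENNReal.ofReal_ne_top (measure_ne_top _ _)]
  refine Finset.sum_congr rfl fun k hk => ?_
  rw [ENNReal.toReal_mul, ENNReal.toReal_ofReal
    (Real.rpow_nonneg (ratio_pos (Finset.mem_Icc.1 hk).1).le _), measureReal_def]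

theorem mul_preimage_le (hm : IsSelfSimilar n s m) (E : Set ℝ) {k : ℕ} (hk : k ∈ Finset.Icc 1 n) :
    ratio k ^ s * m.real (g k ⁻¹' E) ≤ m.real E := by
  rw [hm.real_eq E]
  exact Finset.single_le_sum (f := fun k => ratio k ^ s * m.real (g k ⁻¹' E)) (fun i hi =>
    mul_nonneg (Real.rpow_nonneg (ratio_pos (Finset.mem_Icc.1 hi).1).le _) measureReal_nonneg) hk

theorem measure_eq_zero (hm : IsSelfSimilar n s m) {E : Set ℝ} (hE : ∀ x ∈ Ioo (0 : ℝ) 1, x ∉ E) :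
    m E = 0 :=
  measure_mono_null (fun x hx h => hE x h hx) hm.compl_Ioo

theorem measure_eq_one (hm : IsSelfSimilar n s m) {E : Set ℝ} (hE : Icc 0 1 ⊆ E) : m E = 1 := by
  have := hm.prob
  refine le_antisymm prob_le_one ?_
  calc (1 : ℝ≥0∞) = m univ := measure_univ.symm
    _ ≤ m E + m Eᶜ := by rw [← union_compl_self E]; exact measure_union_le _ _
    _ = m E := by rw [hm.measure_eq_zero (E := Eᶜ) fun x hx h => h (hE (Ioo_subset_Icc_self hx)),
                      add_zero]

theorem real_eq_one (hm : IsSelfSimilar n s m) {E : Set ℝ} (hE : Icc 0 1 ⊆ E) : m.real E = 1 := by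
  rw [measureReal_def, hm.measure_eq_one hE, ENNReal.toReal_one]

theorem mono (hm : IsSelfSimilar n s m) {E F : Set ℝ} (h : E ⊆ F) : m.real E ≤ m.real F := by
  have := hm.prob
  exact measureReal_mono h

/-- Cylinders strictly between those of a and b are fully covered and weigh at least their length,
as `ratio i` ≤ `ratio i` ^ s. Only the two end pieces lose mass, and rescaling shrinks their error ε
by `ratio k` and `ratio j`. -/
theorem le_real_Icc_of_lt (hm : IsSelfSimilar n s m) (hs : s ≤ 1) {ε : ℝ}
    (H : ∀ a b, 0 ≤ a → a ≤ b → b ≤ 1 → b - a - ε ≤ m.real (Icc a b)) {j k : ℕ} (hj : 1 ≤ j)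
    (hjk : j < k) (hkn : k ≤ n) {a b : ℝ} (ha : a ∈ Icc (1 / ((k : ℝ) + 1)) (1 / (k : ℝ)))
    (hb : b ∈ Icc (1 / ((j : ℝ) + 1)) (1 / (j : ℝ))) :
    b - a - ε * (ratio k + ratio j) ≤ m.real (Icc a b) := by
  have hk : 1 ≤ k := by omega
  have hcast : ∀ {p q : ℕ}, 1 ≤ p → p ≤ q → 1 / (q : ℝ) ≤ 1 / (p : ℝ) := by
    intro p q hp hpq
    have h1 : (0 : ℝ) < p := by exact_mod_cast hp
    have h2 : (p : ℝ) ≤ q := by exact_mod_cast hpq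
    gcongr
  have hjk' : 1 / (k : ℝ) ≤ 1 / ((j : ℝ) + 1) := by
    have := hcast (p := j + 1) (q := k) (by omega) hjk
    push_cast at this
    exact this
  have h1 : ∑ i ∈ Finset.Ico j (k + 1), ratio i * m.real (g i ⁻¹' Icc a b) ≤ m.real (Icc a b) := by
    rw [hm.real_eq (Icc a b)]
    calc _ ≤ ∑ i ∈ Finset.Icc 1 n, ratio i * m.real (g i ⁻¹' Icc a b) := by
          refine Finset.sum_le_sum_of_subset_of_nonneg ?_ ?_
          · intro i hi
            simp only [Finset.mem_Ico, Finset.mem_Icc] at hi ⊢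
            omega
          · intro i hi _
            exact mul_nonneg (ratio_pos (Finset.mem_Icc.1 hi).1).le measureReal_nonneg
      _ ≤ _ := Finset.sum_le_sum fun i hi => mul_le_mul_of_nonneg_right
          (ratio_le_rpow hs (Finset.mem_Icc.1 hi).1) measureReal_nonneg
  rw [Finset.sum_Ico_succ_top hjk.le, Finset.sum_eq_sum_Ico_succ_bot hjk] at h1
  have hmid : ∑ i ∈ Finset.Ico (j + 1) k, ratio i * m.real (g i ⁻¹' Icc a b) =
      1 / ((j : ℝ) + 1) - 1 / (k : ℝ) := by
    have := sum_ratio_Ico (j := j + 1) (k := k) hjk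
    push_cast at this
    rw [← this]
    refine Finset.sum_congr rfl fun i hi => ?_
    obtain ⟨hi1, hi2⟩ := Finset.mem_Ico.1 hi
    rw [hm.real_eq_one, mul_one]
    intro y hy
    have hg := g_mem_Icc (k := i) (by omega) hy
    have e1 := hcast (p := i + 1) (q := k) (by omega) hi2
    have e2 := hcast (p := j + 1) (q := i) (by omega) hi1
    push_cast at e1 e2
    exact ⟨by linarith [ha.2, hg.1], by linarith [hb.1, hg.2]⟩
  have hfa := f_mem_Icc hk ha
  have hfb := f_mem_Icc hj hb
  -- Branches reverse orientation: the part of cylinder k to the right of a pulls back to [0, `f k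
  -- a`].
  have hka : f k a - 0 - ε ≤ m.real (g k ⁻¹' Icc a b) := by
    refine (H 0 (f k a) le_rfl hfa.1 hfa.2).trans (hm.mono fun y hy => ?_)
    have hg := g_mem_Icc hk ⟨hy.1, hy.2.trans hfa.2⟩
    refine ⟨?_, by linarith [hg.2, hb.1]⟩
    have := g_sub k (f k a) y
    rw [g_f hk] at this
    nlinarith [hy.2, ratio_pos hk]
  have hjb : 1 - f j b - ε ≤ m.real (g j ⁻¹' Icc a b) := by
    refine (H (f j b) 1 hfb.1 hfb.2 le_rfl).trans (hm.mono fun y hy => ?_)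
    have hg := g_mem_Icc hj ⟨hfb.1.trans hy.1, hy.2⟩
    refine ⟨by linarith [hg.1, ha.2], ?_⟩
    have := g_sub j (f j b) y
    rw [g_f hj] at this
    nlinarith [hy.1, ratio_pos hj]
  have e1 := mul_le_mul_of_nonneg_left hka (ratio_pos hk).le
  have e2 := mul_le_mul_of_nonneg_left hjb (ratio_pos hj).le
  have e3 := ratio_mul_f hk a
  have e4 := ratio_mul_f hj b
  have e5 := one_div_succ_add_ratio j
  rw [hmid] at h1
  linarith

theorem le_real_Icc_of_eq (hm : IsSelfSimilar n s m) (hs : s ≤ 1) {ε : ℝ}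
    (H : ∀ a b, 0 ≤ a → a ≤ b → b ≤ 1 → b - a - ε ≤ m.real (Icc a b)) {k : ℕ} (hk : 1 ≤ k)
    (hkn : k ≤ n) {a b : ℝ} (ha : a ∈ Icc (1 / ((k : ℝ) + 1)) (1 / (k : ℝ)))
    (hb : b ∈ Icc (1 / ((k : ℝ) + 1)) (1 / (k : ℝ))) (hab : a ≤ b) :
    b - a - ε * ratio k ≤ m.real (Icc a b) := by
  have hfa := f_mem_Icc hk ha
  have hfb := f_mem_Icc hk hb
  have e3 := ratio_mul_f hk a
  have e4 := ratio_mul_f hk b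
  have hr := ratio_pos hk
  have hle : f k b ≤ f k a := by
    refine le_of_mul_le_mul_left ?_ hr
    linarith
  have h1 : f k a - f k b - ε ≤ m.real (g k ⁻¹' Icc a b) := by
    refine (H _ _ hfb.1 hle hfa.2).trans (hm.mono fun y hy => ?_)
    have h3 := g_sub k (f k a) y
    have h4 := g_sub k (f k b) y
    rw [g_f hk] at h3 h4
    constructor <;> nlinarith [hy.1, hy.2]
  have h2 := (mul_le_mul_of_nonneg_right (ratio_le_rpow hs hk) measureReal_nonneg).trans
    (hm.mul_preimage_le (Icc a b) (Finset.mem_Icc.2 ⟨hk, hkn⟩))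
  have e1 := mul_le_mul_of_nonneg_left h1 hr.le
  linarith

/-- An admissible error ε improves to 1/(n+1) + (2/3)ε: the gap [0, 1/(n+1)] costs its length, and
two distinct end cylinders cost at most `ratio 1` + `ratio 2` = 2/3 of ε. The fixed point is
3/(n+1), and iteration starts from a trivial error above 1. -/
theorem le_real_Icc (hm : IsSelfSimilar n s m) (hn : 1 ≤ n) (hs : s ≤ 1) {a b : ℝ} (ha : 0 ≤ a)
    (hab : a ≤ b) (hb : b ≤ 1) : b - a - 3 / ((n : ℝ) + 1) ≤ m.real (Icc a b) := by
  have key : ∀ l : ℕ, ∀ a b : ℝ, 0 ≤ a → a ≤ b → b ≤ 1 →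
      b - a - (3 / ((n : ℝ) + 1) + (2 / 3) ^ l) ≤ m.real (Icc a b) := by
    intro l
    have hn0 : (0 : ℝ) < 1 / ((n : ℝ) + 1) := by positivity
    have hn3 : 3 / ((n : ℝ) + 1) = 3 * (1 / ((n : ℝ) + 1)) := by ring
    rw [hn3]
    induction l with
    | zero =>
      intro a b ha hab hb
      have : 0 ≤ m.real (Icc a b) := measureReal_nonneg
      rw [pow_zero]
      linarith
    | succ l ih =>
      set ε := 3 * (1 / ((n : ℝ) + 1)) + (2 / 3) ^ l with hε
      have hpow : (0 : ℝ) < (2 / 3) ^ l := by positivity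
      have hεpos : 0 < ε := by positivity
      have main : ∀ a b : ℝ, 1 / ((n : ℝ) + 1) ≤ a → a ≤ b → b ≤ 1 →
          b - a - 2 / 3 * ε ≤ m.real (Icc a b) := by
        intro a b ha hab hb
        obtain ⟨k, hk, hak⟩ := exists_mem_cylinder hn ha (hab.trans hb)
        obtain ⟨j, hj, hbj⟩ := exists_mem_cylinder hn (ha.trans hab) hb
        rw [Finset.mem_Icc] at hk hj
        rcases lt_trichotomy j k with h | h | h
        · refine le_trans ?_ (hm.le_real_Icc_of_lt hs ih hj.1 h hk.2 hak hbj)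
          have h1 := ratio_le_half hj.1
          have h2 := ratio_anti (j := 2) (k := k) (by norm_num) (by omega)
          rw [ratio_two] at h2
          nlinarith
        · subst h
          refine le_trans ?_ (hm.le_real_Icc_of_eq hs ih hj.1 hj.2 hak hbj hab)
          have h1 := ratio_le_half hj.1
          nlinarith
        · have h1 : 1 / (j : ℝ) ≤ 1 / ((k : ℝ) + 1) := by
            have h2 : (k : ℝ) + 1 ≤ j := by exact_mod_cast h
            gcongr
          have : 0 ≤ m.real (Icc a b) := measureReal_nonneg
          linarith [hak.1, hbj.2]
      intro a b ha hab hb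
      have hε' : 3 * (1 / ((n : ℝ) + 1)) + (2 / 3) ^ (l + 1) = 1 / ((n : ℝ) + 1) + 2 / 3 * ε := by
        rw [hε]; ring
      rw [hε']
      rcases le_total (1 / ((n : ℝ) + 1)) a with h | h
      · linarith [main a b h hab hb]
      · rcases le_total (1 / ((n : ℝ) + 1)) b with h' | h'
        · have h1 := main _ b le_rfl h' hb
          have h2 := hm.mono (Icc_subset_Icc_left (b := b) h)
          linarith
        · have : 0 ≤ m.real (Icc a b) := measureReal_nonneg
          linarith
  have hlim : Tendsto (fun l : ℕ => b - a - (3 / ((n : ℝ) + 1) + (2 / 3 : ℝ) ^ l)) atTop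
      (𝓝 (b - a - (3 / ((n : ℝ) + 1) + 0))) :=
    ((tendsto_pow_atTop_nhds_zero_of_lt_one (by norm_num) (by norm_num)).const_add _).const_sub _
  rw [add_zero] at hlim
  exact le_of_tendsto' hlim fun l => key l a b ha hab hb

/-! ## Lower bounds for the measure of balls -/

theorem le_real_closedBall_of_ratio_lt (hm : IsSelfSimilar n s m) (hs : s ≤ 1) {k : ℕ} (hk : 1 ≤ k)
    (hkn : k ≤ n) {x r : ℝ} (hx : x ∈ Icc (1 / ((k : ℝ) + 1)) (1 / (k : ℝ))) (hkr : ratio k < r)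
    (hr1 : r ≤ 1) : r * (1 - 12 / ((n : ℝ) + 1)) ≤ m.real (closedBall x r) := by
  have hn : 1 ≤ n := hk.trans hkn
  have hr : 0 < r := (ratio_pos hk).trans hkr
  have hx01 := Icc_cylinder_subset hk hx
  have hn0 : (0 : ℝ) < 1 / ((n : ℝ) + 1) := by positivity
  rw [show 12 / ((n : ℝ) + 1) = 4 * (3 * (1 / ((n : ℝ) + 1))) by ring]
  have hn3 : 3 / ((n : ℝ) + 1) = 3 * (1 / ((n : ℝ) + 1)) := by ring
  have H : ∀ a b : ℝ, 0 ≤ a → a ≤ b → b ≤ 1 →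
      b - a - 3 * (1 / ((n : ℝ) + 1)) ≤ m.real (Icc a b) := fun a b h0 h1 h2 => by
    rw [← hn3]; exact hm.le_real_Icc hn hs h0 h1 h2
  rw [Real.closedBall_eq_Icc]
  set ε := 3 * (1 / ((n : ℝ) + 1)) with hε
  have hε0 : 0 < ε := by positivity
  -- If [x, x+r] fits in [0,1], its errors come from cylinders of length below r and at most 3r,
  -- whence 4 · 3/(n+1) = 12/(n+1). Otherwise either the ball contains [0,1], or r ≥ 1/2 and [x-r,
  -- x] suffices.
  rcases le_total (x + r) 1 with h | h
  · refine le_trans ?_ (hm.mono (Icc_subset_Icc_left (show x - r ≤ x by linarith)))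
    have hxn : 1 / ((n : ℝ) + 1) ≤ x := by
      refine le_trans ?_ hx.1
      have : (k : ℝ) ≤ n := by exact_mod_cast hkn
      gcongr
    obtain ⟨j, hj, hyj⟩ := exists_mem_cylinder hn (by linarith : 1 / ((n : ℝ) + 1) ≤ x + r) h
    rw [Finset.mem_Icc] at hj
    have hjk : j < k := by
      by_contra hkj
      rw [not_lt] at hkj
      have h1 : 1 / (j : ℝ) ≤ 1 / (k : ℝ) := by
        have h2 : (k : ℝ) ≤ j := by exact_mod_cast hkj
        have h3 : (0 : ℝ) < k := by exact_mod_cast hk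
        gcongr
      linarith [one_div_succ_add_ratio k, hx.1, hyj.2]
    have h1 := hm.le_real_Icc_of_lt hs H hj.1 hjk hkn hx hyj
    have h2 : ratio j ≤ 3 * r := by
      -- Cylinder j+1 is either cylinder k itself or lies inside [x, x+r]; in both cases its length
      -- is at most r.
      have h3 := ratio_le_three_mul hj.1
      rcases Nat.lt_or_ge (j + 1) k with h4 | h4
      · have h5 : 1 / (k : ℝ) ≤ 1 / ((j : ℝ) + 1 + 1) := by
          have h6 : (j : ℝ) + 1 + 1 ≤ k := by exact_mod_cast h4
          gcongr
        have h7 := one_div_succ_add_ratio (j + 1)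
        push_cast at h7
        linarith [hx.2, hyj.1]
      · have : k = j + 1 := by omega
        subst this
        linarith
    nlinarith
  · rcases le_total (x - r) 0 with h' | h'
    · rw [hm.real_eq_one (Icc_subset_Icc h' h)]
      nlinarith
    · have hr2 : 1 / 2 ≤ r := by
        rcases hk.eq_or_lt with rfl | h2
        · exact (ratio_one ▸ hkr).le
        · have h2' : (2 : ℝ) ≤ k := by exact_mod_cast h2
          have h3 : 1 / (k : ℝ) ≤ 1 / 2 := by gcongr
          linarith [hx.2]
      refine le_trans ?_ (hm.mono (Icc_subset_Icc_right (show x ≤ x + r by linarith)))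
      have := H (x - r) x h' (by linarith) hx01.2
      nlinarith

end IsSelfSimilar

/-! ### Support on the limit set, and small balls by rescaling -/

namespace IsSelfSimilar

variable {n : ℕ} {s : ℝ} {m : Measure ℝ}

theorem measure_null_of_preimage (hm : IsSelfSimilar n s m) {E : Set ℝ}
    (hE : ∀ k, 1 ≤ k → k ≤ n → m (g k ⁻¹' E) = 0) : m E = 0 := by
  rw [hm.apply_eq]
  refine Finset.sum_eq_zero fun k hk => ?_
  rw [hE k (Finset.mem_Icc.1 hk).1 (Finset.mem_Icc.1 hk).2, mul_zero]

theorem measure_compl_J (hm : IsSelfSimilar n s m) : m (J n)ᶜ = 0 := by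
  have key : ∀ l : ℕ, m (⋃ (q : List ℕ) (_ : q.length = l ∧ ∀ k ∈ q, 1 ≤ k ∧ k ≤ n),
      gWord q '' Icc 0 1)ᶜ = 0 := by
    intro l
    induction l with
    | zero =>
      refine hm.measure_eq_zero fun x hx h => h ?_
      exact mem_iUnion₂.2 ⟨[], by simp, x, Ioo_subset_Icc_self hx, rfl⟩
    | succ l ih =>
      refine hm.measure_null_of_preimage fun k hk hkn => measure_mono_null ?_ ih
      intro y hy hy'
      obtain ⟨q, ⟨hql, hq⟩, z, hz, rfl⟩ := mem_iUnion₂.1 hy'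
      refine hy (mem_iUnion₂.2 ⟨k :: q, ⟨by simp [hql], ?_⟩, z, hz, rfl⟩)
      intro i hi
      rcases List.mem_cons.1 hi with rfl | hi
      · exact ⟨hk, hkn⟩
      · exact hq i hi
  unfold J
  simp only [compl_iInter]
  exact measure_iUnion_null fun l => measure_iUnion_null fun _ => key l

end IsSelfSimilar

/-- The constant for which `m (closedBall x r) ≥ ballConst n s * (2 * r) ^ s` on `J n`. -/
noncomputable def ballConst (n : ℕ) (s : ℝ) : ℝ :=
  (1 - 12 / ((n : ℝ) + 1)) / (2 * ratio n ^ (s - 1))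

theorem one_le_ratio_rpow {n : ℕ} {s : ℝ} (hn : 1 ≤ n) (hs : s ≤ 1) : 1 ≤ ratio n ^ (s - 1) :=
  Real.one_le_rpow_of_pos_of_le_one_of_nonpos (ratio_pos hn)
    ((ratio_le_half hn).trans (by norm_num)) (by linarith)

theorem ballConst_pos {n : ℕ} {s : ℝ} (hn : 12 ≤ n) (hs : s ≤ 1) : 0 < ballConst n s := by
  have h1 := one_le_ratio_rpow (n := n) (by omega) hs
  have hn' : (12 : ℝ) ≤ n := by exact_mod_cast hn
  refine div_pos ?_ (by linarith)
  rw [sub_pos, div_lt_one (by linarith)]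
  linarith

theorem rpow_eq_mul_rpow_sub_one {t : ℝ} (ht : 0 < t) (s : ℝ) : t ^ s = t * t ^ (s - 1) := by
  rw [Real.rpow_sub_one ht.ne', mul_div_cancel₀ _ ht.ne']

theorem ballConst_mul_le {n : ℕ} {s r : ℝ} (hn : 12 ≤ n) (hs : s ≤ 1) (hr : ratio n ≤ r) :
    ballConst n s * (2 * r) ^ s ≤ r * (1 - 12 / ((n : ℝ) + 1)) := by
  have h1 := one_le_ratio_rpow (n := n) (by omega) hs
  have hrn := ratio_pos (k := n) (by omega)
  have h2 : (2 * r) ^ (s - 1) ≤ ratio n ^ (s - 1) :=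
    Real.rpow_le_rpow_of_nonpos hrn (by linarith) (by linarith)
  have h3 := (ballConst_pos hn hs).le
  calc ballConst n s * (2 * r) ^ s
      = ballConst n s * ((2 * r) * (2 * r) ^ (s - 1)) := by
        rw [rpow_eq_mul_rpow_sub_one (by linarith)]
    _ ≤ ballConst n s * ((2 * r) * ratio n ^ (s - 1)) := by
        gcongr
        linarith
    _ = r * (1 - 12 / ((n : ℝ) + 1)) := by
        unfold ballConst
        field_simp

namespace IsSelfSimilar

variable {n : ℕ} {s : ℝ} {m : Measure ℝ}

/-- While r ≤ `ratio k`, applying the inverse branch multiplies both sides by the same power, at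
least doubles r and removes one letter. The bound on r by the word length ensures that the word can
run out only at r = 1, where the ball contains [0,1]. -/
theorem le_real_closedBall_gWord (hm : IsSelfSimilar n s m) (hn : 12 ≤ n) (hs : s ≤ 1)
    {q : List ℕ} (hq : ∀ k ∈ q, 1 ≤ k ∧ k ≤ n) {z : ℝ} (hz : z ∈ Icc (0 : ℝ) 1) {r : ℝ}
    (hrq : (1 / 2) ^ q.length ≤ r) (hr : r ≤ 1) :
    ballConst n s * (2 * r) ^ s ≤ m.real (closedBall (gWord q z) r) := by
  have hmem : ∀ p : List ℕ, (∀ k ∈ p, 1 ≤ k ∧ k ≤ n) → gWord p z ∈ Icc (0 : ℝ) 1 := by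
    intro p hp
    induction p with
    | nil => exact hz
    | cons k p ih =>
      exact mapsTo_g (hp k List.mem_cons_self).1 (ih fun i hi => hp i (List.mem_cons_of_mem _ hi))
  induction q generalizing r with
  | nil =>
    have hr1 : r = 1 := le_antisymm hr (by simpa using hrq)
    subst hr1
    rw [hm.real_eq_one]
    · refine (ballConst_mul_le hn hs ((ratio_le_half (by omega)).trans (by norm_num))).trans ?_
      have : 0 ≤ 12 / ((n : ℝ) + 1) := by positivity
      linarith
    · rw [Real.closedBall_eq_Icc]
      have hz' : gWord [] z = z := rfl
      rw [hz']
      exact Icc_subset_Icc (by linarith [hz.2]) (by linarith [hz.1])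
  | cons k q ih =>
    obtain ⟨hk, hkn⟩ := hq k List.mem_cons_self
    have hq' : ∀ k ∈ q, 1 ≤ k ∧ k ≤ n := fun i hi => hq i (List.mem_cons_of_mem _ hi)
    have hcons : gWord (k :: q) z = g k (gWord q z) := rfl
    rw [hcons]
    have hrk := ratio_pos hk
    rcases le_or_gt r (ratio k) with h | h
    · have hr0 : 0 < r := lt_of_lt_of_le (by positivity) hrq
      have h1 : (1 / 2) ^ q.length ≤ r / ratio k := by
        rw [le_div_iff₀ hrk]
        rw [List.length_cons, pow_succ] at hrq
        exact le_trans (by gcongr; exact ratio_le_half hk) hrq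
      have h2 := ih hq' h1 ((div_le_one hrk).2 h)
      have h3 := hm.mul_preimage_le (closedBall (g k (gWord q z)) r) (Finset.mem_Icc.2 ⟨hk, hkn⟩)
      rw [preimage_g_closedBall hk] at h3
      refine le_trans ?_ h3
      calc ballConst n s * (2 * r) ^ s
          = ratio k ^ s * (ballConst n s * (2 * (r / ratio k)) ^ s) := by
            rw [← mul_div_assoc, Real.div_rpow (by linarith) hrk.le]
            have := (Real.rpow_pos_of_pos hrk s).ne'
            field_simp
        _ ≤ _ := by gcongr
    · exact (ballConst_mul_le hn hs ((ratio_anti hk hkn).trans h.le)).trans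
        (hm.le_real_closedBall_of_ratio_lt hs hk hkn (g_mem_Icc hk (hmem q hq')) h hr)

theorem le_measure_closedBall (hm : IsSelfSimilar n s m) (hn : 12 ≤ n) (hs : s ≤ 1) {x : ℝ}
    (hx : x ∈ J n) {r : ℝ} (hr0 : 0 < r) (hr : r ≤ 1) :
    ENNReal.ofReal (ballConst n s * (2 * r) ^ s) ≤ m (closedBall x r) := by
  have := hm.prob
  obtain ⟨l, hl⟩ := exists_pow_lt_of_lt_one hr0 (show (1 / 2 : ℝ) < 1 by norm_num)
  obtain ⟨q, ⟨hql, hq⟩, z, hz, rfl⟩ := mem_iUnion₂.1 (mem_iInter₂.1 hx (l + 1) (by omega))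
  rw [← ofReal_measureReal]
  refine ENNReal.ofReal_le_ofReal (hm.le_real_closedBall_gWord hn hs hq hz ?_ hr)
  rw [hql]
  exact (pow_le_pow_of_le_one (by norm_num) (by norm_num) (Nat.le_succ l)).trans hl.le

end IsSelfSimilar

/-! ## Comparison of packing measures with a measure -/

theorem ediam_closedBall_real (x r : ℝ) :
    ediam (closedBall x r) = ENNReal.ofReal (2 * r) := by
  rw [Real.closedBall_eq_Icc, Real.ediam_Icc]
  congr 1; ring

theorem packingDelta_le_of_le_measure {s δ c : ℝ} (hc : 0 < c) {m : Measure ℝ} {E : Set ℝ}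
    (H : ∀ x ∈ E, ∀ r, 0 < r → r ≤ δ → ENNReal.ofReal (c * (2 * r) ^ s) ≤ m (closedBall x r)) :
    packingDelta s δ E ≤ m univ / ENNReal.ofReal c := by
  refine iSup₂_le fun R hR => ?_
  have hc' : ENNReal.ofReal c ≠ 0 := by simpa using hc
  rw [ENNReal.le_div_iff_mul_le (Or.inl hc') (Or.inl ENNReal.ofReal_ne_top), ← ENNReal.tsum_mul_right]
  have hball : ∀ B : R, ediam (B : Set ℝ) ^ s * ENNReal.ofReal c ≤ m B := by
    rintro ⟨B, hB⟩
    obtain ⟨x, hx, r, hr, hrδ, rfl⟩ := hR.isBall B hB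
    refine le_trans (le_of_eq ?_) (H x hx r hr hrδ)
    rw [ediam_closedBall_real, ENNReal.ofReal_rpow_of_pos (by linarith),
      ← ENNReal.ofReal_mul (Real.rpow_nonneg (by linarith) _), mul_comm]
  have hmeas : ∀ B ∈ R, MeasurableSet B := by
    intro B hB
    obtain ⟨x, -, r, -, -, rfl⟩ := hR.isBall B hB
    exact measurableSet_closedBall
  calc ∑' B : R, ediam (B : Set ℝ) ^ s * ENNReal.ofReal c ≤ ∑' B : R, m B :=
        ENNReal.tsum_le_tsum hball
    _ = m (⋃ B ∈ R, B) := (measure_biUnion hR.countable hR.pairwiseDisjoint hmeas).symm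
    _ ≤ m univ := measure_mono (subset_univ _)

theorem packingPremeasure_empty (s : ℝ) : packingPremeasure s ∅ = 0 := by
  refine le_antisymm ((iInf₂_le 1 one_pos).trans (iSup₂_le fun R hR => ?_)) bot_le
  have : IsEmpty R := ⟨fun B => by
    obtain ⟨x, hx, -⟩ := hR.isBall B B.2
    exact hx⟩
  simp

theorem packingMeasure_le_premeasure (s : ℝ) (E : Set ℝ) :
    packingMeasure s E ≤ packingPremeasure s E := by
  refine (iInf₂_le (fun i : ℕ => if i = 0 then E else ∅) ?_).trans ?_
  · exact fun x hx => mem_iUnion.2 ⟨0, by simpa using hx⟩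
  · rw [tsum_eq_single 0 fun i hi => by simp [hi, packingPremeasure_empty]]
    simp

theorem packingMeasure_le_of_le_measure {s δ c : ℝ} (hc : 0 < c) (hδ : 0 < δ) {m : Measure ℝ}
    {E : Set ℝ}
    (H : ∀ x ∈ E, ∀ r, 0 < r → r ≤ δ → ENNReal.ofReal (c * (2 * r) ^ s) ≤ m (closedBall x r)) :
    packingMeasure s E ≤ m univ / ENNReal.ofReal c :=
  (packingMeasure_le_premeasure s E).trans
    ((iInf₂_le δ hδ).trans (packingDelta_le_of_le_measure hc H))

/-- For radii at most η, (2r)^t ≤ (2η)^(t-s) (2r)^s, so the density constant for t is c /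
(2η)^(t-s), which blows up as η → 0. -/
theorem packingMeasure_eq_zero_of_le_measure {s t δ c : ℝ} (hc : 0 < c) (hδ : 0 < δ) (hst : s < t)
    {m : Measure ℝ} [IsFiniteMeasure m] {E : Set ℝ}
    (H : ∀ x ∈ E, ∀ r, 0 < r → r ≤ δ → ENNReal.ofReal (c * (2 * r) ^ s) ≤ m (closedBall x r)) :
    packingMeasure t E = 0 := by
  refine le_antisymm ?_ bot_le
  have key : ∀ η : ℝ, 0 < η → η ≤ δ →
      packingMeasure t E ≤ m univ / ENNReal.ofReal c * ENNReal.ofReal ((2 * η) ^ (t - s)) := by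
    intro η hη hηδ
    have hη' : 0 < (2 * η) ^ (t - s) := Real.rpow_pos_of_pos (by linarith) _
    have h1 := packingMeasure_le_of_le_measure (s := t) (δ := η) (c := c / (2 * η) ^ (t - s))
      (div_pos hc hη') hη (m := m) (E := E) ?_
    · refine h1.trans (le_of_eq ?_)
      rw [ENNReal.ofReal_div_of_pos hη', div_eq_mul_inv, ENNReal.inv_div, div_eq_mul_inv,
        div_eq_mul_inv]
      · ring
      · exact Or.inl ENNReal.ofReal_ne_top
      · exact Or.inl (by simpa using hη')
    · intro x hx r hr hrη
      refine le_trans (ENNReal.ofReal_le_ofReal ?_) (H x hx r hr (hrη.trans hηδ))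
      have h2 : (2 * r) ^ (t - s) ≤ (2 * η) ^ (t - s) :=
        Real.rpow_le_rpow (by linarith) (by linarith) (by linarith)
      have h3 : (2 * r) ^ t = (2 * r) ^ s * (2 * r) ^ (t - s) := by
        rw [← Real.rpow_add (by linarith)]; congr 1; ring
      rw [h3, div_mul_eq_mul_div, div_le_iff₀ hη']
      have h4 : 0 ≤ (2 * r) ^ s := Real.rpow_nonneg (by linarith) _
      rw [← mul_assoc]
      gcongr
  have hlim : Tendsto (fun η : ℝ => m univ / ENNReal.ofReal c * ENNReal.ofReal ((2 * η) ^ (t - s)))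
      (𝓝[>] 0) (𝓝 (m univ / ENNReal.ofReal c * ENNReal.ofReal ((2 * 0) ^ (t - s)))) := by
    refine ENNReal.Tendsto.const_mul ?_ (Or.inr ?_)
    · refine (ENNReal.tendsto_ofReal ?_).mono_left nhdsWithin_le_nhds
      have hcont : Continuous fun η : ℝ => (2 * η) ^ (t - s) :=
        (continuous_const.mul continuous_id).rpow_const fun _ => Or.inr (by linarith)
      exact hcont.tendsto 0
    · exact ENNReal.div_ne_top (measure_ne_top _ _) (by simpa using hc)
  rw [mul_zero, Real.zero_rpow (by linarith), ENNReal.ofReal_zero, mul_zero] at hlim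
  refine ge_of_tendsto hlim ?_
  filter_upwards [Ioc_mem_nhdsGT hδ] with η hη
  exact key η hη.1 hη.2

theorem packingMeasure_anti {s t : ℝ} (hst : s ≤ t) (E : Set ℝ) :
    packingMeasure t E ≤ packingMeasure s E := by
  refine iInf₂_mono fun F _ => ENNReal.tsum_le_tsum fun i => le_iInf₂ fun δ hδ => ?_
  -- Radii at most 1/2 give diameters at most 1, whose powers decrease in the exponent.
  refine (iInf₂_le (min δ (1 / 2)) (by positivity)).trans (iSup₂_le fun R hR => ?_)
  have hR' : IsPacking δ (F i) R := ⟨hR.countable, hR.pairwiseDisjoint, fun B hB => by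
    obtain ⟨x, hx, r, hr, hrδ, rfl⟩ := hR.isBall B hB
    exact ⟨x, hx, r, hr, hrδ.trans (min_le_left _ _), rfl⟩⟩
  refine le_trans (ENNReal.tsum_le_tsum ?_) (le_iSup₂_of_le R hR' le_rfl)
  rintro ⟨B, hB⟩
  obtain ⟨x, hx, r, hr, hrδ, rfl⟩ := hR.isBall B hB
  refine ENNReal.rpow_le_rpow_of_exponent_ge ?_ hst
  rw [ediam_closedBall_real]
  refine ENNReal.ofReal_le_one.2 ?_
  linarith [hrδ.trans (min_le_right _ _)]

/-- Besicovitch's theorem selects disjoint light balls covering almost all of E. The set E is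
arbitrary because the pieces in the definition of `packingMeasure` need not be measurable. -/
theorem div_le_packingDelta {s δ a : ℝ} (hδ : 0 < δ) {m : Measure ℝ}
    [IsFiniteMeasure m] (E : Set ℝ)
    (H : ∀ᵐ x ∂m, ∀ η : ℝ, 0 < η → ∃ r, 0 < r ∧ r < η ∧
      m (closedBall x r) ≤ ENNReal.ofReal (a * (2 * r) ^ s)) :
    m E / ENNReal.ofReal a ≤ packingDelta s δ E := by
  set A : Set ℝ := {x | ∀ η : ℝ, 0 < η → ∃ r, 0 < r ∧ r < η ∧
      m (closedBall x r) ≤ ENNReal.ofReal (a * (2 * r) ^ s)} with hA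
  obtain ⟨t, r, htc, htE, htr, htcov, htd⟩ := Besicovitch.exists_disjoint_closedBall_covering_ae m
    (fun x => {r | m (closedBall x r) ≤ ENNReal.ofReal (a * (2 * r) ^ s)}) (E ∩ A)
    (fun x hx η hη => by
      obtain ⟨r, h0, h1, h2⟩ := hx.2 η hη
      exact ⟨r, h2, h0, h1⟩) (fun _ => δ) fun _ _ => hδ
  set R : Set (Set ℝ) := (fun x => closedBall x (r x)) '' t with hR
  have hpack : IsPacking δ E R := by
    refine ⟨htc.image _, ?_, ?_⟩
    · rintro _ ⟨x, hx, rfl⟩ _ ⟨y, hy, rfl⟩ hxy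
      exact htd hx hy fun h => hxy (by rw [h])
    · rintro _ ⟨x, hx, rfl⟩
      exact ⟨x, (htE hx).1, r x, (htr x hx).2.1, (htr x hx).2.2.le, rfl⟩
  refine le_trans ?_ (le_iSup₂_of_le R hpack le_rfl)
  refine ENNReal.div_le_of_le_mul ?_
  have h1 : m E ≤ m (⋃ B ∈ R, B) := by
    have h2 : E ⊆ (⋃ B ∈ R, B) ∪ ((E ∩ A) \ ⋃ x ∈ t, closedBall x (r x)) ∪ Aᶜ := by
      intro x hx
      by_cases hxA : x ∈ A
      · left
        by_cases hxu : x ∈ ⋃ x ∈ t, closedBall x (r x)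
        · left
          rw [hR, biUnion_image]
          exact hxu
        · exact Or.inr ⟨⟨hx, hxA⟩, hxu⟩
      · exact Or.inr hxA
    refine (measure_mono h2).trans ((measure_union_le _ _).trans ?_)
    rw [show m Aᶜ = 0 from H, add_zero]
    refine (measure_union_le _ _).trans ?_
    rw [htcov, add_zero]
  refine h1.trans ((measure_biUnion_le m hpack.countable _).trans ?_)
  rw [← ENNReal.tsum_mul_right]
  refine ENNReal.tsum_le_tsum ?_
  rintro ⟨_, x, hx, rfl⟩
  have hrx := (htr x hx).2.1
  refine (htr x hx).1.trans (le_of_eq ?_)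
  dsimp only
  rw [ediam_closedBall_real, ENNReal.ofReal_rpow_of_pos (by linarith),
    ← ENNReal.ofReal_mul (Real.rpow_nonneg (by linarith) _), mul_comm]

theorem div_le_packingMeasure {s a : ℝ} {m : Measure ℝ} [IsFiniteMeasure m]
    (E : Set ℝ)
    (H : ∀ᵐ x ∂m, ∀ η : ℝ, 0 < η → ∃ r, 0 < r ∧ r < η ∧
      m (closedBall x r) ≤ ENNReal.ofReal (a * (2 * r) ^ s)) :
    m E / ENNReal.ofReal a ≤ packingMeasure s E := by
  refine le_iInf₂ fun F hF => ?_
  calc m E / ENNReal.ofReal a ≤ (∑' i, m (F i)) / ENNReal.ofReal a := by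
        gcongr
        exact (measure_mono hF).trans (measure_iUnion_le _)
    _ = ∑' i, m (F i) / ENNReal.ofReal a := by simp only [div_eq_mul_inv, ENNReal.tsum_mul_right]
    _ ≤ _ := ENNReal.tsum_le_tsum fun i => le_iInf₂ fun δ hδ => div_le_packingDelta hδ _ H

/-! ## Balls of small measure -/

theorem closedBall_g_subset {k : ℕ} (hk : 1 ≤ k) {x ρ : ℝ}
    (h : closedBall x ρ ⊆ Icc (0 : ℝ) 1) :
    closedBall (g k x) (ratio k * ρ) ⊆ Icc (1 / ((k : ℝ) + 1)) (1 / (k : ℝ)) := by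
  intro z hz
  rw [← g_f hk z] at hz ⊢
  refine g_mem_Icc hk (h ?_)
  have hz' : f k z ∈ g k ⁻¹' closedBall (g k x) (ratio k * ρ) := hz
  rwa [preimage_g_closedBall hk, mul_div_cancel_left₀ _ (ratio_pos hk).ne'] at hz'

/-- The points which are centers of a ball in `[0, 1]` of radius `ρ ≤ 2 ^ (-l)` and of measure
at most `a * (2 * ρ) ^ s`. -/
def lightPoints (m : Measure ℝ) (a s : ℝ) (l : ℕ) : Set ℝ :=
  {x | ∃ ρ : ℝ, 0 < ρ ∧ ρ ≤ (1 / 2) ^ l ∧ closedBall x ρ ⊆ Icc 0 1 ∧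
    m.real (closedBall x ρ) ≤ a * (2 * ρ) ^ s}

/-- The constant for which almost every point is the center of arbitrarily small balls of measure
at most `lightConst n s * (2 * r) ^ s`. -/
noncomputable def lightConst (n : ℕ) (s : ℝ) : ℝ :=
  ratio n ^ (s - 1) * (((n : ℝ) + 3) / (2 * ((n : ℝ) - 1)))

namespace IsSelfSimilar

variable {n : ℕ} {s : ℝ} {m : Measure ℝ}

/-- A ball inside [0,1] maps into a single cylinder, which meets the others in null endpoints at
most, so its mass scales exactly. This is why `lightPoints` demands containment. -/
theorem real_closedBall_g (hm : IsSelfSimilar n s m) {k : ℕ} (hk : 1 ≤ k) (hkn : k ≤ n) {x ρ : ℝ}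
    (h : closedBall x ρ ⊆ Icc (0 : ℝ) 1) :
    m.real (closedBall (g k x) (ratio k * ρ)) = ratio k ^ s * m.real (closedBall x ρ) := by
  rw [hm.real_eq, Finset.sum_eq_single_of_mem k (Finset.mem_Icc.2 ⟨hk, hkn⟩),
    preimage_g_closedBall hk, mul_div_cancel_left₀ _ (ratio_pos hk).ne']
  intro j hj hjk
  have hj1 := (Finset.mem_Icc.1 hj).1
  rw [measureReal_def, hm.measure_eq_zero, ENNReal.toReal_zero, mul_zero]
  intro y hy hy'
  have h1 := closedBall_g_subset hk h hy'
  have h2 := g_eq j y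
  have h3 := mul_pos (ratio_pos hj1) hy.1
  have h4 := mul_lt_mul_of_pos_left hy.2 (ratio_pos hj1)
  have h5 := one_div_succ_add_ratio j
  have hj0 : (0 : ℝ) < j := by exact_mod_cast hj1
  have hk0 : (0 : ℝ) < k := by exact_mod_cast hk
  rcases lt_or_gt_of_ne hjk with h6 | h6
  · have h7 : (j : ℝ) + 1 ≤ k := by exact_mod_cast h6
    have h8 : 1 / (k : ℝ) ≤ 1 / ((j : ℝ) + 1) := by gcongr
    linarith [h1.2]
  · have h7 : (k : ℝ) + 1 ≤ j := by exact_mod_cast h6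
    have h8 : 1 / (j : ℝ) ≤ 1 / ((k : ℝ) + 1) := by gcongr
    linarith [h1.1]

theorem g_mem_lightPoints (hm : IsSelfSimilar n s m) {a : ℝ} {l k : ℕ} (hk : 1 ≤ k) (hkn : k ≤ n)
    {x : ℝ} (hx : x ∈ lightPoints m a s l) : g k x ∈ lightPoints m a s (l + 1) := by
  obtain ⟨ρ, h0, hl, hsub, hle⟩ := hx
  have hr := ratio_pos hk
  refine ⟨ratio k * ρ, mul_pos hr h0, ?_,
    (closedBall_g_subset hk hsub).trans (Icc_cylinder_subset hk), ?_⟩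
  · rw [pow_succ, mul_comm]
    exact mul_le_mul hl (ratio_le_half hk) hr.le (by positivity)
  · rw [hm.real_closedBall_g hk hkn hsub, mul_left_comm, Real.mul_rpow hr.le (by linarith),
      mul_left_comm]
    exact mul_le_mul_of_nonneg_left hle (Real.rpow_nonneg hr.le _)

/-- Only cylinders with k ≥ ⌊n/2⌋ can contribute. Their lengths telescope to at most 2/(n-1) -
1/(n+1), which is the second factor of `lightConst` times 2/(n+1). -/
theorem real_Icc_two_div_le (hm : IsSelfSimilar n s m) (hn : 2 ≤ n) (hs : s ≤ 1) :
    m.real (Icc 0 (2 / (n : ℝ))) ≤ lightConst n s * (2 / ((n : ℝ) + 1)) := by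
  have hn' : (2 : ℝ) ≤ n := by exact_mod_cast hn
  have hprob := hm.prob
  have h1 : m.real (Icc 0 (2 / (n : ℝ))) ≤
      ∑ k ∈ Finset.Ico (n / 2) (n + 1), ratio n ^ (s - 1) * ratio k := by
    rw [hm.real_eq]
    have hsub : Finset.Ico (n / 2) (n + 1) ⊆ Finset.Icc 1 n := by
      intro k hk
      simp only [Finset.mem_Ico, Finset.mem_Icc] at hk ⊢
      omega
    rw [← Finset.sum_subset hsub]
    · refine Finset.sum_le_sum fun k hk => ?_
      obtain ⟨hk1, hkn⟩ := Finset.mem_Icc.1 (hsub hk)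
      have hr := ratio_pos hk1
      rw [rpow_eq_mul_rpow_sub_one hr, mul_comm (ratio n ^ _)]
      calc _ ≤ ratio k * ratio k ^ (s - 1) * 1 := by
            gcongr
            exact measureReal_le_one
        _ ≤ _ := by
            rw [mul_one]
            gcongr ?_ * ?_
            exact Real.rpow_le_rpow_of_nonpos (ratio_pos (by omega)) (ratio_anti hk1 hkn)
              (by linarith)
    · intro k hk hk'
      rw [measureReal_def, hm.measure_eq_zero, ENNReal.toReal_zero, mul_zero]
      intro y hy hy'
      obtain ⟨hk1, hkn⟩ := Finset.mem_Icc.1 hk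
      have h2 := g_eq k y
      have h4 := mul_lt_mul_of_pos_left hy.2 (ratio_pos hk1)
      have h5 := one_div_succ_add_ratio k
      have h6 : 2 * k + 2 ≤ n := by
        simp only [Finset.mem_Ico, not_and_or, not_le, not_lt] at hk'
        omega
      have h7 : 2 * (k : ℝ) + 2 ≤ n := by exact_mod_cast h6
      have h8 : 2 / (n : ℝ) ≤ 1 / ((k : ℝ) + 1) := by
        rw [div_le_div_iff₀ (by linarith) (by positivity)]
        linarith
      linarith [hy'.2]
  refine h1.trans ?_
  rw [← Finset.mul_sum, sum_ratio_Ico (by omega), lightConst, mul_assoc]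
  refine mul_le_mul_of_nonneg_left ?_ (Real.rpow_nonneg (ratio_pos (by omega)).le _)
  have h2 : ((n : ℝ) - 1) / 2 ≤ ((n / 2 : ℕ) : ℝ) := by
    have : n ≤ 2 * (n / 2) + 1 := by omega
    have : (n : ℝ) ≤ 2 * ((n / 2 : ℕ) : ℝ) + 1 := by exact_mod_cast this
    linarith
  have h3 : 0 < ((n : ℝ) - 1) / 2 := by linarith
  calc 1 / ((n / 2 : ℕ) : ℝ) - 1 / ((n + 1 : ℕ) : ℝ)
      ≤ 1 / (((n : ℝ) - 1) / 2) - 1 / ((n : ℝ) + 1) := by push_cast; gcongr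
    _ = _ := by
        have : (n : ℝ) - 1 ≠ 0 := by linarith
        field_simp
        ring

theorem g_self_mem_lightPoints (hm : IsSelfSimilar n s m) (hn : 2 ≤ n) (hs : s ≤ 1) {z : ℝ}
    (hz : z ∈ Icc (0 : ℝ) 1) : g n z ∈ lightPoints m (lightConst n s) s 0 := by
  have hn' : (2 : ℝ) ≤ n := by exact_mod_cast hn
  have hg := g_mem_Icc (by omega : 1 ≤ n) hz
  have h1 : 1 / ((n : ℝ) + 1) ≤ 1 / n := by gcongr; linarith
  have h2 : 2 / (n : ℝ) = 2 * (1 / n) := by ring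
  have hsub : closedBall (g n z) (1 / ((n : ℝ) + 1)) ⊆ Icc 0 (2 / (n : ℝ)) := by
    rw [Real.closedBall_eq_Icc]
    exact Icc_subset_Icc (by linarith [hg.1]) (by linarith [hg.2])
  refine ⟨1 / ((n : ℝ) + 1), by positivity, ?_, hsub.trans (Icc_subset_Icc_right ?_), ?_⟩
  · rw [pow_zero, div_le_one (by linarith)]
    linarith
  · rwa [div_le_one (by linarith)]
  · refine (hm.mono hsub).trans ((hm.real_Icc_two_div_le hn hs).trans ?_)
    have h3 : 2 * (1 / ((n : ℝ) + 1)) = 2 / ((n : ℝ) + 1) := by ring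
    have h4 : 0 ≤ lightConst n s :=
      mul_nonneg (Real.rpow_nonneg (ratio_pos (by omega)).le _)
        (div_nonneg (by linarith) (by linarith))
    rw [h3]
    refine mul_le_mul_of_nonneg_left ?_ h4
    have h5 : 2 / ((n : ℝ) + 1) ≤ 1 := by
      rw [div_le_one (by linarith)]; linarith
    have := Real.rpow_le_rpow_of_exponent_ge (by positivity) h5 hs
    rwa [Real.rpow_one] at this

theorem measure_compl_lightPoints (hm : IsSelfSimilar n s m) (hn : 2 ≤ n) (hs : s ≤ 1) (l : ℕ) :
    m (lightPoints m (lightConst n s) s l)ᶜ = 0 := by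
  have hprob := hm.prob
  set G := lightPoints m (lightConst n s) s with hG
  have hstep : ∀ l k, 1 ≤ k → k ≤ n → g k ⁻¹' (G (l + 1))ᶜ ⊆ (G l)ᶜ :=
    fun l k hk hkn x hx hx' => hx (hm.g_mem_lightPoints hk hkn hx')
  have hG10 : G 1 ⊆ G 0 := by
    rintro x ⟨ρ, h0, h1, h2⟩
    exact ⟨ρ, h0, h1.trans (by norm_num), h2⟩
  induction l with
  | zero =>
    have hr := ratio_pos (by omega : 1 ≤ n)
    have hpos : 0 < ratio n ^ s := Real.rpow_pos_of_pos hr s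
    have hsum : ∑ k ∈ Finset.Icc 1 n, ratio k ^ s = 1 := by
      have := hm.real_eq univ
      simpa using this.symm
    -- Points with first letter n are light, and any branch keeps light points light. So the
    -- exceptional set loses the fixed fraction `ratio n` ^ s of its mass and must be null.
    have h1 : m.real (G 0)ᶜ ≤ (1 - ratio n ^ s) * m.real (G 0)ᶜ := by
      have hmem : n ∈ Finset.Icc 1 n := Finset.mem_Icc.2 ⟨by omega, le_rfl⟩
      calc m.real (G 0)ᶜ = ∑ k ∈ Finset.Icc 1 n, ratio k ^ s * m.real (g k ⁻¹' (G 0)ᶜ) :=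
            hm.real_eq _
        _ = ∑ k ∈ (Finset.Icc 1 n).erase n, ratio k ^ s * m.real (g k ⁻¹' (G 0)ᶜ) := by
            have h0 : m (g n ⁻¹' (G 0)ᶜ) = 0 := hm.measure_eq_zero fun z hz hz' =>
              hz' (hm.g_self_mem_lightPoints hn hs (Ioo_subset_Icc_self hz))
            rw [← Finset.add_sum_erase _ _ hmem, measureReal_def, h0, ENNReal.toReal_zero, mul_zero, zero_add]
        _ ≤ ∑ k ∈ (Finset.Icc 1 n).erase n, ratio k ^ s * m.real (G 0)ᶜ := by
            refine Finset.sum_le_sum fun k hk => ?_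
            obtain ⟨hk1, hkn⟩ := Finset.mem_Icc.1 (Finset.mem_of_mem_erase hk)
            refine mul_le_mul_of_nonneg_left (hm.mono ?_) (Real.rpow_nonneg (ratio_pos hk1).le _)
            exact (preimage_mono (compl_subset_compl.2 hG10)).trans (hstep 0 k hk1 hkn)
        _ = _ := by
            rw [← Finset.sum_mul, ← hsum, ← Finset.add_sum_erase _ _ hmem, add_sub_cancel_left]
    have h2 : m.real (G 0)ᶜ = 0 := by
      have : 0 ≤ m.real (G 0)ᶜ := measureReal_nonneg
      nlinarith
    rwa [measureReal_eq_zero_iff] at h2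
  | succ l ih =>
    exact hm.measure_null_of_preimage fun k hk hkn => measure_mono_null (hstep l k hk hkn) ih

theorem ae_exists_closedBall_le (hm : IsSelfSimilar n s m) (hn : 2 ≤ n) (hs : s ≤ 1) :
    ∀ᵐ x ∂m, ∀ η : ℝ, 0 < η → ∃ r, 0 < r ∧ r < η ∧
      m (closedBall x r) ≤ ENNReal.ofReal (lightConst n s * (2 * r) ^ s) := by
  have hprob := hm.prob
  filter_upwards [ae_all_iff.2 fun l => measure_eq_zero_iff_ae_notMem.1
    (hm.measure_compl_lightPoints hn hs l)] with x hx η hη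
  obtain ⟨l, hl⟩ := exists_pow_lt_of_lt_one hη (show (1 / 2 : ℝ) < 1 by norm_num)
  obtain ⟨ρ, h0, h1, -, h2⟩ := not_not.1 (hx l)
  refine ⟨ρ, h0, h1.trans_lt hl, ?_⟩
  rw [← ofReal_measureReal]
  exact ENNReal.ofReal_le_ofReal h2

/-! ## The packing measure of the limit set -/

theorem packingMeasure_le (hm : IsSelfSimilar n s m) (hn : 12 ≤ n) (hs : s ≤ 1) :
    packingMeasure s (J n) ≤ ENNReal.ofReal (ballConst n s)⁻¹ := by
  have := hm.prob
  have hc := ballConst_pos hn hs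
  have h1 := packingMeasure_le_of_le_measure hc one_pos fun x hx r => hm.le_measure_closedBall hn hs hx
  rwa [measure_univ, one_div, ← ENNReal.ofReal_inv_of_pos hc] at h1

theorem le_packingMeasure (hm : IsSelfSimilar n s m) (hn : 2 ≤ n) (hs : s ≤ 1) :
    ENNReal.ofReal (lightConst n s)⁻¹ ≤ packingMeasure s (J n) := by
  have := hm.prob
  have hn' : (2 : ℝ) ≤ n := by exact_mod_cast hn
  have hc : 0 < lightConst n s :=
    mul_pos (Real.rpow_pos_of_pos (ratio_pos (by omega)) _) (div_pos (by linarith) (by linarith))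
  have h1 := div_le_packingMeasure (J n) (hm.ae_exists_closedBall_le hn hs)
  have h2 : m (J n) = 1 := by
    refine le_antisymm prob_le_one ?_
    calc (1 : ℝ≥0∞) = m univ := measure_univ.symm
      _ ≤ m (J n) + m (J n)ᶜ := by rw [← union_compl_self (J n)]; exact measure_union_le _ _
      _ = m (J n) := by rw [hm.measure_compl_J, add_zero]
  rwa [h2, one_div, ← ENNReal.ofReal_inv_of_pos hc] at h1

theorem h_eq (hm : IsSelfSimilar n s m) (hn : 12 ≤ n) (hs0 : 0 ≤ s) (hs : s ≤ 1) : h n = s := by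
  have hprob := hm.prob
  have hpos : packingMeasure s (J n) ≠ 0 := by
    have hn' : (12 : ℝ) ≤ n := by exact_mod_cast hn
    have hc : 0 < lightConst n s :=
      mul_pos (Real.rpow_pos_of_pos (ratio_pos (by omega)) _) (div_pos (by linarith) (by linarith))
    exact ((ENNReal.ofReal_pos.2 (inv_pos.2 hc)).trans_le
      (hm.le_packingMeasure (by omega) hs)).ne'
  have hzero : ∀ t, s < t → packingMeasure t (J n) = 0 := fun t ht =>
    packingMeasure_eq_zero_of_le_measure (ballConst_pos hn hs) one_pos ht
      fun x hx r => hm.le_measure_closedBall hn hs hx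
  refine csInf_eq_of_forall_ge_of_forall_gt_exists_lt ⟨s + 1, by linarith, hzero _ (by linarith)⟩ ?_ ?_
  · rintro t ⟨-, ht⟩
    by_contra hts
    exact hpos (le_antisymm ((packingMeasure_anti (not_le.1 hts).le _).trans ht.le) bot_le)
  · intro w hw
    exact ⟨(s + w) / 2, ⟨by linarith, hzero _ (by linarith)⟩, by linarith⟩

end IsSelfSimilar

/-! ## The dimension equation and the limit -/

theorem exists_sum_ratio_rpow_eq_one {n : ℕ} (hn : 1 ≤ n) :
    ∃ s : ℝ, 0 ≤ s ∧ s ≤ 1 ∧ ∑ k ∈ Finset.Icc 1 n, ratio k ^ s = 1 := by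
  have hcont : ContinuousOn (fun s : ℝ => ∑ k ∈ Finset.Icc 1 n, ratio k ^ s) (Icc 0 1) := by
    refine continuousOn_finsetSum _ fun k hk => Continuous.continuousOn ?_
    exact continuous_const.rpow continuous_id
      fun _ => Or.inl (ratio_pos (Finset.mem_Icc.1 hk).1).ne'
  have h1 : (1 : ℝ) ∈ Icc (∑ k ∈ Finset.Icc 1 n, ratio k ^ (1 : ℝ))
      (∑ k ∈ Finset.Icc 1 n, ratio k ^ (0 : ℝ)) := by
    constructor
    · simp only [Real.rpow_one, sum_ratio_Icc]
      have : 0 ≤ 1 / ((n : ℝ) + 1) := by positivity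
      linarith
    · simpa using hn
  obtain ⟨s, hs, h⟩ := intermediate_value_Icc' zero_le_one hcont h1
  exact ⟨s, hs.1, hs.2, h⟩

/-- Since every ratio is at most 1/2, `ratio k` ^ (s-1) ≥ 2^(1-s) ≥ 1 + (1-s)/2, using log 2 > 1/2.
Summing gives (n/(n+1))(1 + (1-s)/2) ≤ 1. -/
theorem one_sub_le_two_div {n : ℕ} {s : ℝ} (hn : 1 ≤ n) (hs : s ≤ 1)
    (hsum : ∑ k ∈ Finset.Icc 1 n, ratio k ^ s = 1) : 1 - s ≤ 2 / (n : ℝ) := by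
  have hn' : (1 : ℝ) ≤ n := by exact_mod_cast hn
  have h1 : ∀ k ∈ Finset.Icc 1 n, ratio k * (1 + (1 - s) / 2) ≤ ratio k ^ s := by
    intro k hk
    have hk1 := (Finset.mem_Icc.1 hk).1
    have hr := ratio_pos hk1
    rw [rpow_eq_mul_rpow_sub_one hr]
    refine mul_le_mul_of_nonneg_left ?_ hr.le
    have h2 : (1 / 2 : ℝ) ^ (s - 1) ≤ ratio k ^ (s - 1) :=
      Real.rpow_le_rpow_of_nonpos hr (ratio_le_half hk1) (by linarith)
    refine le_trans ?_ h2
    rw [Real.rpow_def_of_pos (by norm_num), one_div, Real.log_inv]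
    have h3 := Real.add_one_le_exp (-Real.log 2 * (s - 1))
    have h4 := Real.log_two_gt_d9
    nlinarith
  have h2 := Finset.sum_le_sum h1
  rw [← Finset.sum_mul, hsum, sum_ratio_Icc] at h2
  have h3 : 1 - 1 / ((n : ℝ) + 1) = n / (n + 1) := by field_simp; ring
  rw [h3, div_mul_eq_mul_div, div_le_one (by linarith)] at h2
  rw [le_div_iff₀ (by linarith)]
  linarith

/-- From `ratio n` ≥ n^(-3) and 1 - s ≤ 2/n the power is at most n^(6/n), which tends to 1. -/
theorem ratio_rpow_le {n : ℕ} {s : ℝ} (hn : 2 ≤ n) (hs : s ≤ 1)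
    (hsum : ∑ k ∈ Finset.Icc 1 n, ratio k ^ s = 1) :
    ratio n ^ (s - 1) ≤ ((n : ℝ) ^ (1 / (n : ℝ))) ^ 6 := by
  have hn' : (2 : ℝ) ≤ n := by exact_mod_cast hn
  have h1 := one_sub_le_two_div (by omega) hs hsum
  have h2 : ((n : ℝ) ^ 3)⁻¹ ≤ ratio n := by
    rw [ratio_eq (by omega), ← one_div]
    gcongr
    have : (n : ℝ) + 1 ≤ (n : ℝ) ^ 2 := by nlinarith
    calc (n : ℝ) * (n + 1) ≤ n * n ^ 2 := by gcongr
      _ = n ^ 3 := by ring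
  calc ratio n ^ (s - 1) ≤ (((n : ℝ) ^ 3)⁻¹) ^ (s - 1) :=
        Real.rpow_le_rpow_of_nonpos (by positivity) h2 (by linarith)
    _ = (n : ℝ) ^ (3 * (1 - s)) := by
        rw [Real.inv_rpow (by positivity), ← Real.rpow_neg (by positivity), ← Real.rpow_natCast,
          ← Real.rpow_mul (by positivity)]
        congr 1
        push_cast
        ring
    _ ≤ (n : ℝ) ^ (1 / (n : ℝ) * (6 : ℕ)) := by
        refine Real.rpow_le_rpow_of_exponent_le (by linarith) ?_
        push_cast
        have : 1 / (n : ℝ) * 6 = 3 * (2 / n) := by ring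
        linarith
    _ = _ := by rw [Real.rpow_mul (by positivity), Real.rpow_natCast]

theorem tendsto_ratio_rpow {S : ℕ → ℝ}
    (hS : ∀ n, 1 ≤ n → S n ≤ 1 ∧ ∑ k ∈ Finset.Icc 1 n, ratio k ^ S n = 1) :
    Tendsto (fun n => ratio n ^ (S n - 1)) atTop (𝓝 1) := by
  have h1 : Tendsto (fun n : ℕ => ((n : ℝ) ^ (1 / (n : ℝ))) ^ 6) atTop (𝓝 1) := by
    simpa using (tendsto_rpow_div.comp tendsto_natCast_atTop_atTop).pow 6
  refine tendsto_of_tendsto_of_tendsto_of_le_of_le' tendsto_const_nhds h1 ?_ ?_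
  · filter_upwards [eventually_ge_atTop 1] with n hn
    exact one_le_ratio_rpow hn (hS n hn).1
  · filter_upwards [eventually_ge_atTop 2] with n hn
    obtain ⟨h2, h3⟩ := hS n (by omega)
    exact ratio_rpow_le hn h2 h3

theorem tendsto_inv_ballConst {S : ℕ → ℝ}
    (hS : Tendsto (fun n => ratio n ^ (S n - 1)) atTop (𝓝 1)) :
    Tendsto (fun n => (ballConst n (S n))⁻¹) atTop (𝓝 2) := by
  have h1 : Tendsto (fun n : ℕ => 1 - 12 / ((n : ℝ) + 1)) atTop (𝓝 1) := by
    have := (tendsto_one_div_add_atTop_nhds_zero_nat (𝕜 := ℝ)).const_mul 12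
    simpa [div_eq_mul_inv] using this.const_sub 1
  have h2 := (hS.const_mul 2).div h1 one_ne_zero
  rw [mul_one, div_one] at h2
  refine h2.congr fun n => ?_
  rw [ballConst, inv_div, Pi.div_apply]

theorem tendsto_inv_lightConst {S : ℕ → ℝ}
    (hS : Tendsto (fun n => ratio n ^ (S n - 1)) atTop (𝓝 1)) :
    Tendsto (fun n => (lightConst n (S n))⁻¹) atTop (𝓝 2) := by
  have h1 : Tendsto (fun n : ℕ => ((n : ℝ) + 3) / (2 * ((n : ℝ) - 1))) atTop (𝓝 (1 / 2)) := by
    have h2 : Tendsto (fun n : ℕ => (1 + 3 * (1 / (n : ℝ))) / (2 * (1 - 1 / (n : ℝ)))) atTop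
        (𝓝 ((1 + 3 * 0) / (2 * (1 - 0)))) := by
      have h3 := tendsto_one_div_atTop_nhds_zero_nat (𝕜 := ℝ)
      exact ((h3.const_mul 3).const_add 1).div ((h3.const_sub 1).const_mul 2) (by norm_num)
    rw [show (1 + 3 * 0) / (2 * (1 - 0)) = (1 / 2 : ℝ) by norm_num] at h2
    refine h2.congr' ?_
    filter_upwards [eventually_ge_atTop 2] with n hn
    have hn' : (2 : ℝ) ≤ n := by exact_mod_cast hn
    have : (n : ℝ) - 1 ≠ 0 := by linarith
    field_simp
  have := (hS.mul h1).inv₀ (by norm_num)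
  simpa [lightConst] using this

end LinearGauss

theorem mainTheorem1 :
    Tendsto (fun n : ℕ => LinearGauss.packingMeasure (LinearGauss.h n) (LinearGauss.J n))
      atTop (𝓝 (2 : ℝ≥0∞)) := by
  open LinearGauss in
  -- The guard 1 ≤ n makes the choice total: for n = 0 the sum is empty and the dimension equation
  -- has no solution.
  have hex : ∀ n : ℕ, ∃ s : ℝ, 1 ≤ n →
      0 ≤ s ∧ s ≤ 1 ∧ ∑ k ∈ Finset.Icc 1 n, ratio k ^ s = 1 := by
    intro n
    rcases Nat.lt_or_ge n 1 with hn | hn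
    · exact ⟨0, fun h => absurd h (by omega)⟩
    · obtain ⟨s, hs⟩ := exists_sum_ratio_rpow_eq_one hn
      exact ⟨s, fun _ => hs⟩
  choose S hS using hex
  have hlim := LinearGauss.tendsto_ratio_rpow fun n hn => (hS n hn).2
  have h2 : (2 : ℝ≥0∞) = ENNReal.ofReal 2 := by simp
  rw [h2]
  refine tendsto_of_tendsto_of_tendsto_of_le_of_le'
    (ENNReal.tendsto_ofReal (LinearGauss.tendsto_inv_lightConst hlim))
    (ENNReal.tendsto_ofReal (LinearGauss.tendsto_inv_ballConst hlim)) ?_ ?_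
  all_goals
    filter_upwards [eventually_ge_atTop 12] with n hn
    obtain ⟨hs0, hs1, hsum⟩ := hS n (by omega)
    obtain ⟨m, hm⟩ := LinearGauss.exists_isSelfSimilar hsum
    rw [hm.h_eq hn hs0 hs1]
  · exact hm.le_packingMeasure (by omega) hs1
  · exact hm.packingMeasure_le hn hs1
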